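/- **Setting.** An instance consists of a finite bipartite graph $G=(S\cup R,E)$ with servers $S$ and requests $R=\{r_1,\dots,r_n\}$ that arrive in this order, success probabilities $p_{s,r}\in[0,1]$ for $\{s,r\}\in E$, capacities $b_s\in\mathbb{N}$ and weights $w_s\ge 0$ for $s\in S$. When a request $r$ arrives, it may be assigned to a server $s$ with $\{s,r\}\in E$ that has had fewer than $b_s$ successful matches so far. The assignment succeeds with probability $p_{s,r}$, independently of the past, and a success is a match of $s$ of value $w_s$; the outcome is observed right after the assignment. If the assignment fails, the request leaves and the remaining capacity of $s$ is unchanged. For an algorithm $\textsc{Alg}$ let $\mathbb{E}[\textsc{Alg}(G)]$ be the expected total weight of its successful matches. **Algorithm.** The load $l_s$ of a server $s$ is the sum of the probabilities $p_{s,r}$ of the requests $r$ assigned to $s$ so far. Let $$f_s(x)=\begin{cases} e^{x/b_s-1}, & x\le b_s,\\ 1, & x>b_s.\end{cases}$$ $\textsc{StochasticBalance}$ assigns an arriving request $r$ to a neighbor $s$ with remaining capacity that maximizes $w_s\cdot p_{s,r}\,(1-f_s(l_s))$ (ties are broken arbitrarily), and leaves $r$ unassigned only if no neighbor of $r$ has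 remaining capacity. **Benchmarks.** The non-stochastic benchmark $\textsc{Opt}(G)$ is the maximum of $\sum_{\{s,r\}\in E}p_{s,r}w_s\,m(s,r)$ over all $m\ge 0$ on $E$ with $\sum_{r:\{s,r\}\in E}p_{s,r}\,m(s,r)\le b_s$ for all $s\in S$ and $\sum_{s:\{s,r\}\in E}m(s,r)\le 1$ for all $r\in R$. The stochastic benchmark $\textsc{SOpt}(G)$ is the maximum expected total weight of successful matches of an algorithm that knows the whole instance, including the edge probabilities, in advance, processes the requests in their arrival order, and learns the outcome of an assignment only after making it. **Theorem.** $\textsc{StochasticBalance}$ achieves a competitive ratio of $1-1/e$ against both benchmarks as $\min_{s\in S}b_s\to\infty$. That is, there is a function $c:\mathbb{N}\to\mathbb{R}$ with $\lim_{b\to\infty}c(b)=1-1/e$ such that for every $b\in\mathbb{N}$, every instance with $b_s\ge b$ for all $s\in S$, and every way of breaking ties, $$\mathbb{E}[\textsc{StochasticBalance}(G)]\ \ge\ c(b)\cdot\textsc{Opt}(G)\qquad\text{and}\qquad \mathbb{E}[\textsc{StochasticBalance}(G)]\ \ge\ c(b)\cdot\textsc{SOpt}(G).$$ -/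

import Mathlib

open Filter Topology

noncomputable section

namespace StochReward

/-- An instance of the vertex-weighted online `b`-matching problem with stochastic rewards:
a bipartite graph with server set `S` and requests `0, …, n - 1` (numbered by order of arrival),
success probabilities of the edges, individual server capacities and server weights.
(The value of `prob` at a pair that is not an edge plays no role.) -/
structure Instance (S : Type*) (n : ℕ) where
  edge : S → Fin n → Prop
  prob : S → Fin n → ℝ
  prob_nonneg : ∀ s r, 0 ≤ prob s r
  prob_le_one : ∀ s r, prob s r ≤ 1
  cap : S → ℕ
  weight : S → ℝ
  weight_nonneg : ∀ s, 0 ≤ weight s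

/-- What has been observed: `h r = some (s, true)` if request `r` was assigned to `s` and this
was a success, `h r = some (s, false)` if it was assigned to `s` without success, and `h r = none`
if `r` was not assigned or has not been processed yet. -/
abbrev History (S : Type*) (n : ℕ) : Type _ := Fin n → Option (S × Bool)

/-- A deterministic adaptive assignment policy: given the arriving request and the history of the
earlier requests, it names a server or leaves the request unassigned. -/
abbrev Policy (S : Type*) (n : ℕ) : Type _ := Fin n → History S n → Option S

/-- A realization of the outcomes: `Z s r` says whether the edge `{s, r}` succeeds
if it is chosen. -/
abbrev Outcome (S : Type*) (n : ℕ) : Type _ := S → Fin n → Bool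

section Run

variable {S : Type*} {n : ℕ}

/-- The decision of the policy `π` for request `r` when it is executed on the realization `Z`:
`π` sees exactly the decisions made for the requests before `r` and the outcomes of those
assignments. -/
def decision (π : Policy S n) (Z : Outcome S n) (r : Fin n) : Option S :=
  π r (fun r' => if _h : r' < r then (decision π Z r').map (fun s => (s, Z s r')) else none)
termination_by r.val

end Run

namespace Instance

variable {S : Type*} {n : ℕ} (I : Instance S n)

/-- The load of `s`: the sum of the edge probabilities of the requests assigned to `s`. -/
def load (h : History S n) (s : S) : ℝ :=
  open Classical in
  ∑ r : Fin n, if (h r).map Prod.fst = some s then I.prob s r else 0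

/-- The number of successful matches of `s`. -/
def numMatches (h : History S n) (s : S) : ℕ :=
  open Classical in
  (Finset.univ.filter (fun r : Fin n => h r = some (s, true))).card

/-- `s` is a neighbour of `r` that has remaining capacity. -/
def Available (h : History S n) (r : Fin n) (s : S) : Prop :=
  I.edge s r ∧ numMatches h s < I.cap s

/-- The policy assigns requests only to neighbours with remaining capacity. -/
def Feasible (π : Policy S n) : Prop :=
  ∀ r h s, π r h = some s → I.Available h r s

/-- The function `f_s` of a server of capacity `b`. -/
def balanceFun (b : ℕ) (x : ℝ) : ℝ :=
  if x ≤ b then Real.exp (x / b - 1) else 1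

/-- The quantity `w_s · p_{s,r} · (1 - f_s(l_s))`. -/
def score (h : History S n) (r : Fin n) (s : S) : ℝ :=
  I.weight s * (I.prob s r * (1 - balanceFun (I.cap s) (I.load h s)))

/-- `π` is an execution rule of StochasticBalance: it assigns each request to a neighbour with
remaining capacity of maximum score, ties being broken in any way, and leaves a request unassigned
only if it has no neighbour with remaining capacity. -/
def IsStochasticBalance (π : Policy S n) : Prop :=
  ∀ r h,
    (∀ s, π r h = some s →
      I.Available h r s ∧ ∀ s', I.Available h r s' → I.score h r s' ≤ I.score h r s) ∧
    (π r h = none → ∀ s, ¬ I.Available h r s)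

/-- The total weight of the successful matches of `π` on the realization `Z`. -/
def reward (π : Policy S n) [Fintype S] (Z : Outcome S n) : ℝ :=
  open Classical in
  ∑ s : S, ∑ r : Fin n, if decision π Z r = some s ∧ Z s r = true then I.weight s else 0

/-- The probability of the realization `Z`: the edges succeed independently, the edge `{s, r}`
with probability `p_{s,r}`. -/
def outcomeProb [Fintype S] (Z : Outcome S n) : ℝ :=
  ∏ s : S, ∏ r : Fin n, if Z s r = true then I.prob s r else 1 - I.prob s r

/-- The expected total weight of the successful matches of `π`. -/
def expectedReward [Fintype S] (π : Policy S n) : ℝ :=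
  open Classical in
  ∑ Z : Outcome S n, I.outcomeProb Z * I.reward π Z

/-- Feasible solutions of the (fractional) budgeted allocation problem. -/
structure IsFractional [Fintype S] (m : S → Fin n → ℝ) : Prop where
  nonneg : ∀ s r, 0 ≤ m s r
  edge : ∀ s r, ¬ I.edge s r → m s r = 0
  cap : ∀ s, ∑ r : Fin n, I.prob s r * m s r ≤ I.cap s
  request : ∀ r, ∑ s : S, m s r ≤ 1

/-- The values of the feasible solutions of the budgeted allocation problem. -/
def fractionalValues [Fintype S] : Set ℝ :=
  {v | ∃ m, I.IsFractional m ∧ v = ∑ s : S, ∑ r : Fin n, I.prob s r * I.weight s * m s r}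

/-- The non-stochastic benchmark `Opt`. -/
def opt [Fintype S] : ℝ := sSup I.fractionalValues

/-- The values of the policies that know the whole instance. -/
def policyValues [Fintype S] : Set ℝ :=
  {v | ∃ π, I.Feasible π ∧ v = I.expectedReward π}

/-- The stochastic (clairvoyant) benchmark `SOpt`. -/
def sopt [Fintype S] : ℝ := sSup I.policyValues

/-! The two suprema are over nonempty sets that are bounded above. -/

theorem fractionalValues_nonempty [Fintype S] : I.fractionalValues.Nonempty :=
  ⟨_, fun _ _ => 0, ⟨fun _ _ => le_rfl, fun _ _ _ => rfl, fun s => by simp, fun r => by simp⟩, rfl⟩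

theorem bddAbove_fractionalValues [Fintype S] : BddAbove I.fractionalValues := by
  refine ⟨∑ s : S, ∑ r : Fin n, I.prob s r * I.weight s, ?_⟩
  rintro v ⟨m, hm, rfl⟩
  refine Finset.sum_le_sum fun s _ => Finset.sum_le_sum fun r _ => ?_
  have h1 : m s r ≤ 1 :=
    (Finset.single_le_sum (f := fun s => m s r) (fun s _ => hm.nonneg s r)
      (Finset.mem_univ s)).trans (hm.request r)
  exact mul_le_of_le_one_right (mul_nonneg (I.prob_nonneg s r) (I.weight_nonneg s)) h1

theorem policyValues_nonempty [Fintype S] : I.policyValues.Nonempty :=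
  ⟨_, fun _ _ => none, fun _ _ _ h => by simp at h, rfl⟩

theorem bddAbove_policyValues [Fintype S] : BddAbove I.policyValues := by
  refine ((Set.finite_range (fun π : Policy S n => I.expectedReward π)).subset ?_).bddAbove
  rintro v ⟨π, -, rfl⟩
  exact ⟨π, rfl⟩

/-- Every instance admits an execution rule of StochasticBalance. -/
theorem exists_isStochasticBalance [Finite S] : ∃ π, I.IsStochasticBalance π := by
  classical
  have key : ∀ r h, ∃ o : Option S,
      (∀ s, o = some s →
        I.Available h r s ∧ ∀ s', I.Available h r s' → I.score h r s' ≤ I.score h r s) ∧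
      (o = none → ∀ s, ¬ I.Available h r s) := by
    intro r h
    by_cases hne : ∃ s, I.Available h r s
    · obtain ⟨s, hs, hmax⟩ := Set.exists_max_image {s | I.Available h r s} (I.score h r)
        (Set.toFinite _) hne
      exact ⟨some s, fun t ht => by cases ht; exact ⟨hs, hmax⟩, fun h => by simp at h⟩
    · exact ⟨none, fun t ht => by simp at ht, fun _ s hs => hne ⟨s, hs⟩⟩
  choose π hπ using key
  exact ⟨π, hπ⟩

end Instance

end StochReward

end

/-! The proof is a primal-dual argument with a randomized dual solution. Each assignment of `r` to
`s` contributes its expected value `w_s p_{s,r}`, which is split at the current load: a share `f_s`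
goes to the price of `s` (spread over `b_s` units), and the share `1 - f_s` goes to the price of
`r`. The dual objective is then the weighted total load, whose expectation is the expected reward.

For an edge `{s, r}`, the price of `s` is a Riemann sum of `f_s / b_s`. Since `f_s' = f_s / b_s`
below capacity, it is at least `w_s (f_s(final load) - 1/e)` up to a factor `1 + 1 / b_s`. If `s` is
available when `r` arrives, the greedy rule pays `r` at least `w_s p_{s,r} (1 - f_s(final load))`,
and the two add up to `(1 - 1/e) w_s p_{s,r}`. If `s` is exhausted, it has `b_s` matches, so `1 -
f_s(final load)` is at most `|matches - load| / b_s` (`IsStochasticBalance.le_price`). Matches minus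
load is a sum of orthogonal martingale differences with variance at most `b_s`, so this error has
mean at most `1 / √b_s`. Hence the expected prices are dual feasible up to vanishing losses, and
weak duality handles Opt. SOpt is at most Opt because assignment probabilities form a fractional
solution. -/

noncomputable section

namespace StochReward

/-! ### Executions and their observed histories. -/

section History

variable {S : Type*} {n : ℕ}

/-- The history observed by `π` on the realization `Z` when the requests satisfying `P` have been
processed. -/
def observed (π : Policy S n) (Z : Outcome S n) (P : Fin n → Prop) : History S n :=
  open Classical in
  fun r => if P r then (decision π Z r).map (fun s => (s, Z s r)) else none

theorem decision_eq (π : Policy S n) (Z : Outcome S n) (r : Fin n) :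
    decision π Z r = π r (observed π Z (· < r)) := by
  rw [decision]
  congr 1
  funext r'
  by_cases h : r' < r <;> simp [observed, h]

/-- The decision for `r` depends only on the outcomes at earlier requests. -/
theorem decision_congr (π : Policy S n) {Z Z' : Outcome S n} (r : Fin n)
    (h : ∀ r' < r, ∀ s, Z s r' = Z' s r') : decision π Z r = decision π Z' r := by
  induction r using WellFoundedLT.induction with
  | ind r ih =>
    rw [decision_eq, decision_eq]
    congr 1
    funext r'
    by_cases hr : r' < r
    · have := ih r' hr (fun r'' h'' => h r'' (h''.trans hr))
      simp [observed, hr, this, h r' hr]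
    · simp [observed, hr]

theorem observed_map_fst (π : Policy S n) (Z : Outcome S n) (P : Fin n → Prop) (r : Fin n)
    (s : S) :
    (observed π Z P r).map Prod.fst = some s ↔ P r ∧ decision π Z r = some s := by
  by_cases h : P r <;> simp [observed, h, Function.comp_def]

theorem observed_eq_some_true (π : Policy S n) (Z : Outcome S n) (P : Fin n → Prop) (r : Fin n)
    (s : S) :
    observed π Z P r = some (s, true) ↔ P r ∧ decision π Z r = some s ∧ Z s r = true := by
  by_cases h : P r
  · simp only [observed, h, if_true, true_and, Option.map_eq_some_iff, Prod.mk.injEq]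
    constructor
    · rintro ⟨a, h1, rfl, h2⟩
      exact ⟨h1, h2⟩
    · rintro ⟨h1, h2⟩
      exact ⟨s, h1, rfl, h2⟩
  · simp [observed, h]

/-- The indicator of the event that `r` is assigned to `s`. -/
def assigned (π : Policy S n) (s : S) (r : Fin n) (Z : Outcome S n) : ℝ :=
  open Classical in if decision π Z r = some s then 1 else 0

/-- The indicator of the success of the edge `{s, r}`. -/
def success (s : S) (r : Fin n) (Z : Outcome S n) : ℝ :=
  if Z s r = true then 1 else 0

theorem assigned_nonneg (π : Policy S n) (s : S) (r : Fin n) (Z : Outcome S n) :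
    0 ≤ assigned π s r Z := by
  unfold assigned; split_ifs <;> norm_num

theorem assigned_mul_self (π : Policy S n) (s : S) (r : Fin n) (Z : Outcome S n) :
    assigned π s r Z * assigned π s r Z = assigned π s r Z := by
  unfold assigned; split_ifs <;> norm_num

theorem assigned_congr (π : Policy S n) (s : S) {Z Z' : Outcome S n} (r : Fin n)
    (h : ∀ r' < r, ∀ s, Z s r' = Z' s r') : assigned π s r Z = assigned π s r Z' := by
  unfold assigned
  rw [decision_congr π r h]

theorem sum_assigned_le_one [Fintype S] (π : Policy S n) (r : Fin n) (Z : Outcome S n) :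
    ∑ s, assigned π s r Z ≤ 1 := by
  classical
  unfold assigned
  cases h : decision π Z r with
  | none => simp
  | some t => simp

/-- The number of matches of `s` in a complete execution. -/
def finalMatches (π : Policy S n) (s : S) (Z : Outcome S n) : ℝ :=
  ∑ r, assigned π s r Z * success s r Z

theorem natCast_numMatches_observed (π : Policy S n) (s : S) (Z : Outcome S n) :
    (Instance.numMatches (observed π Z fun _ => True) s : ℝ) = finalMatches π s Z := by
  classical
  rw [Instance.numMatches, Finset.card_filter, finalMatches]
  push_cast
  refine Finset.sum_congr rfl fun r _ => ?_
  simp only [observed_eq_some_true, true_and, assigned, success]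
  split_ifs <;> simp_all

theorem numMatches_observed_mono (π : Policy S n) (s : S) (Z : Outcome S n)
    {P Q : Fin n → Prop} (h : ∀ r, P r → Q r) :
    Instance.numMatches (observed π Z P) s ≤ Instance.numMatches (observed π Z Q) s := by
  classical
  refine Finset.card_le_card fun r => ?_
  simp only [Finset.mem_filter, Finset.mem_univ, true_and, observed_eq_some_true]
  exact fun ⟨h1, h2⟩ => ⟨h r h1, h2⟩

end History

namespace Instance

variable {S : Type*} {n : ℕ} (I : Instance S n)

/-! ### Analytic estimates for the balance function. -/

theorem balanceFun_nonneg (b : ℕ) (x : ℝ) : 0 ≤ balanceFun b x := by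
  unfold balanceFun; split_ifs <;> positivity

theorem exp_div_sub_one_le_one {b : ℕ} {x : ℝ} (h : x ≤ b) : Real.exp (x / b - 1) ≤ 1 := by
  rw [Real.exp_le_one_iff]
  have := div_le_one_of_le₀ h (Nat.cast_nonneg b)
  linarith

theorem balanceFun_le_one (b : ℕ) (x : ℝ) : balanceFun b x ≤ 1 := by
  unfold balanceFun
  split_ifs with h
  · exact exp_div_sub_one_le_one h
  · exact le_rfl

theorem balanceFun_mono (b : ℕ) : Monotone (balanceFun b) := by
  intro x y hxy
  by_cases hy : y ≤ b
  · simp only [balanceFun, hy, hxy.trans hy, if_true]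
    gcongr
  · rw [show balanceFun b y = 1 by simp [balanceFun, hy]]
    exact balanceFun_le_one b x

theorem balanceFun_zero (b : ℕ) : balanceFun b 0 = Real.exp (-1) := by
  simp [balanceFun]

/-- This is `1 + y ≤ exp y` at `y = x / b - 1`. It is used for exhausted servers, where `b` is the
number of matches and `x` the final load. -/
theorem one_sub_balanceFun_le {b : ℕ} (hb : 0 < b) (x : ℝ) :
    1 - balanceFun b x ≤ |b - x| / b := by
  have hb' : (0 : ℝ) < b := by exact_mod_cast hb
  unfold balanceFun
  split_ifs with h
  · have h1 := Real.add_one_le_exp (x / b - 1)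
    rw [abs_of_nonneg (by linarith), sub_div, div_self hb'.ne']
    linarith
  · rw [sub_self]; positivity

/-- The increments of `f_s` are at most those of its Riemann sum, up to a factor `1 + 1 / b`. -/
theorem balanceFun_add_sub_le {b : ℕ} (hb : 0 < b) (x : ℝ) {p : ℝ} (hp0 : 0 ≤ p) (hp1 : p ≤ 1) :
    balanceFun b (x + p) - balanceFun b x ≤ (1 + 1 / b) * (p * balanceFun b x / b) := by
  have hb' : (1 : ℝ) ≤ b := by exact_mod_cast hb
  by_cases h : x ≤ b
  · have h1 : balanceFun b (x + p) ≤ Real.exp (x / b - 1) * Real.exp (p / b) := by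
      rw [← Real.exp_add]
      unfold balanceFun
      split_ifs with h'
      · exact (congrArg Real.exp (by ring)).le
      -- The step crosses the capacity, where the untruncated exponential is already at least 1.
      · rw [Real.one_le_exp_iff]
        have : 1 ≤ (x + p) / b := by rw [le_div_iff₀ (by linarith)]; linarith
        rw [add_div] at this
        linarith
    have h2 : balanceFun b x = Real.exp (x / b - 1) := by simp [balanceFun, h]
    have hq0 : 0 ≤ p / b := by positivity
    have hq1 : p / b ≤ 1 / b := by gcongr
    have hq2 : p / b ≤ 1 := hq1.trans (by rw [div_le_one (by linarith)]; exact hb')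
    -- `exp q - 1 ≤ q + q ^ 2` for `0 ≤ q ≤ 1`, with one factor `q` bounded by `1 / b`.
    have h3 : Real.exp (p / b) - 1 ≤ (1 + 1 / b) * (p / b) := by
      have := (abs_le.1 (Real.abs_exp_sub_one_sub_id_le (x := p / b)
        (by rw [abs_of_nonneg hq0]; exact hq2))).2
      nlinarith
    rw [h2]
    have h4 := mul_le_mul_of_nonneg_left h3 (Real.exp_nonneg (x / b - 1))
    calc balanceFun b (x + p) - Real.exp (x / b - 1)
        ≤ Real.exp (x / b - 1) * (Real.exp (p / b) - 1) := by linarith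
      _ ≤ _ := h4
      _ = _ := by ring
  · have h1 : balanceFun b x = 1 := by simp [balanceFun, h]
    have h2 := balanceFun_le_one b (x + p)
    have : 0 ≤ (1 + 1 / (b : ℝ)) * (p * balanceFun b x / b) := by rw [h1]; positivity
    linarith

/-- The one-step estimate telescopes: the right side is a left-endpoint Riemann sum of `f / b` along
the partial sums of `a`. -/
theorem balanceFun_sum_sub_le {b : ℕ} (hb : 0 < b) :
    ∀ {k : ℕ} (a : Fin k → ℝ), (∀ i, 0 ≤ a i) → (∀ i, a i ≤ 1) →
      balanceFun b (∑ i, a i) - balanceFun b 0 ≤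
        (1 + 1 / b) * ∑ i, a i * balanceFun b (∑ j, if j < i then a j else 0) / b
  | 0, a, _, _ => by simp
  | k + 1, a, h0, h1 => by
    have ih := balanceFun_sum_sub_le hb (fun i => a (Fin.castSucc i)) (fun _ => h0 _) fun _ => h1 _
    have step := balanceFun_add_sub_le hb (∑ i : Fin k, a (Fin.castSucc i)) (h0 (Fin.last k))
      (h1 (Fin.last k))
    rw [Fin.sum_univ_castSucc, Fin.sum_univ_castSucc]
    have e1 : ∀ i : Fin k, (∑ j, if j < Fin.castSucc i then a j else 0) =
        ∑ j : Fin k, if j < i then a (Fin.castSucc j) else 0 := by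
      intro i
      rw [Fin.sum_univ_castSucc, if_neg (not_lt.2 (Fin.le_last _)), add_zero]
      rfl
    have e2 : (∑ j, if j < Fin.last k then a j else 0) = ∑ j : Fin k, a (Fin.castSucc j) := by
      rw [Fin.sum_univ_castSucc, if_neg (lt_irrefl _), add_zero]
      exact Finset.sum_congr rfl fun j _ => if_pos (Fin.castSucc_lt_last j)
    simp only [e1, e2, mul_add]
    linarith

/-! ### Loads, matches and server prices along one execution. -/

/-- The load of `s` after a complete execution. -/
def finalLoad (π : Policy S n) (s : S) (Z : Outcome S n) : ℝ :=
  ∑ r, assigned π s r Z * I.prob s r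

theorem load_observed_lt (π : Policy S n) (s : S) (r : Fin n) (Z : Outcome S n) :
    I.load (observed π Z (· < r)) s =
      ∑ r', if r' < r then assigned π s r' Z * I.prob s r' else 0 := by
  classical
  unfold load
  refine Finset.sum_congr rfl fun r' _ => ?_
  rw [assigned, ite_mul, one_mul, zero_mul, ← ite_and]
  exact if_congr (observed_map_fst π Z _ r' s) rfl rfl

theorem load_observed_lt_le (π : Policy S n) (s : S) (r : Fin n) (Z : Outcome S n) :
    I.load (observed π Z (· < r)) s ≤ I.finalLoad π s Z := by
  rw [load_observed_lt, finalLoad]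
  refine Finset.sum_le_sum fun r' _ => ?_
  have := mul_nonneg (assigned_nonneg π s r' Z) (I.prob_nonneg s r')
  split_ifs
  · exact le_rfl
  · exact this

variable {I} in
theorem Feasible.finalMatches_le {π : Policy S n} (hπ : I.Feasible π) (s : S) (Z : Outcome S n) :
    finalMatches π s Z ≤ I.cap s := by
  classical
  rw [← natCast_numMatches_observed, Nat.cast_le]
  rcases (Finset.univ.filter fun r : Fin n =>
    observed π Z (fun _ => True) r = some (s, true)).eq_empty_or_nonempty with h | h
  · have : numMatches (observed π Z fun _ => True) s = 0 := by
      rw [numMatches, Finset.card_eq_zero]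
      convert h
    omega
  -- At the last successful request of `s`, feasibility leaves room for one more match, and all
  -- other matches came earlier.
  · obtain ⟨r, hr, hmax⟩ := Finset.exists_max_image _ id h
    simp only [Finset.mem_filter, Finset.mem_univ, true_and, observed_eq_some_true, id] at hr hmax
    have h1 : numMatches (observed π Z (· < r)) s < I.cap s :=
      (hπ r _ s (by rw [← decision_eq π Z r]; exact hr.1)).2
    have h2 : numMatches (observed π Z fun _ => True) s ≤
        numMatches (observed π Z (· < r)) s + 1 := by
      refine le_trans (Finset.card_le_card (t := insert r (Finset.univ.filter fun r' : Fin n =>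
        observed π Z (· < r) r' = some (s, true))) ?_) ((Finset.card_insert_le _ _).trans ?_)
      · intro r' hr'
        simp only [Finset.mem_filter, Finset.mem_univ, true_and, observed_eq_some_true,
          Finset.mem_insert] at hr' ⊢
        rcases (hmax r' hr').lt_or_eq with h3 | h3
        · exact Or.inr ⟨h3, hr'⟩
        · exact Or.inl h3
      · exact le_rfl
    omega

/-- The realization in which the outcome of the edge `{s, r}` is reversed. -/
def flip (s : S) (r : Fin n) (Z : Outcome S n) : Outcome S n :=
  open Classical in fun s' r' => if s' = s ∧ r' = r then !(Z s' r') else Z s' r'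

theorem flip_flip (s : S) (r : Fin n) (Z : Outcome S n) : flip s r (flip s r Z) = Z := by
  funext s' r'
  by_cases h : s' = s ∧ r' = r <;> simp [flip, h]

theorem flip_of_ne (s : S) {r r' : Fin n} (h : r' ≠ r) (Z : Outcome S n) (s' : S) :
    flip s r Z s' r' = Z s' r' := by
  simp [flip, h]

/-- The case `r' = r` is included, since a decision precedes its own outcome. -/
theorem assigned_flip (π : Policy S n) (s t : S) {r r' : Fin n} (h : r' ≤ r) (Z : Outcome S n) :
    assigned π t r' (flip s r Z) = assigned π t r' Z :=
  assigned_congr π t r' fun _ h' _ => flip_of_ne s (h'.trans_le h).ne Z _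

/-- The deviation at `r` of the number of matches of `s` from its load. -/
def deviation (π : Policy S n) (s : S) (r : Fin n) (Z : Outcome S n) : ℝ :=
  assigned π s r Z * (success s r Z - I.prob s r)

theorem finalMatches_sub_finalLoad (π : Policy S n) (s : S) (Z : Outcome S n) :
    finalMatches π s Z - I.finalLoad π s Z = ∑ r, I.deviation π s r Z := by
  rw [finalMatches, finalLoad, ← Finset.sum_sub_distrib]
  exact Finset.sum_congr rfl fun r _ => by rw [deviation, mul_sub]

theorem finalLoad_nonneg (π : Policy S n) (s : S) (Z : Outcome S n) : 0 ≤ I.finalLoad π s Z :=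
  Finset.sum_nonneg fun r _ => mul_nonneg (assigned_nonneg π s r Z) (I.prob_nonneg s r)

/-- The value of `f_s` at the load of `s` at the arrival of `r`. -/
def balanceAt (π : Policy S n) (s : S) (r : Fin n) (Z : Outcome S n) : ℝ :=
  balanceFun (I.cap s) (I.load (observed π Z (· < r)) s)

/-- The price of a unit of capacity of `s` in an execution of `π`. -/
def serverPrice (π : Policy S n) (s : S) (Z : Outcome S n) : ℝ :=
  I.weight s * ∑ r, assigned π s r Z * I.prob s r * I.balanceAt π s r Z / I.cap s

theorem serverPrice_nonneg (π : Policy S n) (s : S) (Z : Outcome S n) :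
    0 ≤ I.serverPrice π s Z := by
  refine mul_nonneg (I.weight_nonneg s) (Finset.sum_nonneg fun r _ => div_nonneg (mul_nonneg
    (mul_nonneg (assigned_nonneg π s r Z) (I.prob_nonneg s r)) (balanceFun_nonneg _ _))
    (Nat.cast_nonneg _))

/-- The price is `w_s` times the Riemann sum along the load of `s`; the constant `exp (-1)` is
`f_s(0)`. -/
theorem le_serverPrice (π : Policy S n) (s : S) (hs : 0 < I.cap s) (Z : Outcome S n) :
    I.weight s * (balanceFun (I.cap s) (I.finalLoad π s Z) - Real.exp (-1)) ≤
      (1 + 1 / I.cap s) * I.serverPrice π s Z := by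
  have h := balanceFun_sum_sub_le hs (fun r => assigned π s r Z * I.prob s r)
    (fun r => mul_nonneg (assigned_nonneg π s r Z) (I.prob_nonneg s r))
    (fun r => by
      have h1 := I.prob_le_one s r
      unfold assigned; split_ifs <;> simp [h1])
  rw [balanceFun_zero] at h
  simp only [← load_observed_lt] at h
  refine (mul_le_mul_of_nonneg_left h (I.weight_nonneg s)).trans_eq ?_
  rw [serverPrice]
  simp only [balanceAt]
  ring

variable {I} in
theorem IsStochasticBalance.feasible {π : Policy S n} (hπ : I.IsStochasticBalance π) :
    I.Feasible π :=
  fun r h s hs => ((hπ r h).1 s hs).1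

/-! ### Expectations and concentration of matches around the load. -/

section Expectation

variable [Fintype S]

/-- Expectation over the independent edge outcomes. -/
def expect (X : Outcome S n → ℝ) : ℝ :=
  open Classical in ∑ Z : Outcome S n, I.outcomeProb Z * X Z

theorem outcomeProb_nonneg (Z : Outcome S n) : 0 ≤ I.outcomeProb Z := by
  refine Finset.prod_nonneg fun s _ => Finset.prod_nonneg fun r _ => ?_
  split_ifs
  · exact I.prob_nonneg s r
  · exact sub_nonneg.2 (I.prob_le_one s r)

theorem expect_mono {X Y : Outcome S n → ℝ} (h : ∀ Z, X Z ≤ Y Z) : I.expect X ≤ I.expect Y :=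
  Finset.sum_le_sum fun Z _ => mul_le_mul_of_nonneg_left (h Z) (I.outcomeProb_nonneg Z)

theorem expect_add (X Y : Outcome S n → ℝ) :
    I.expect (fun Z => X Z + Y Z) = I.expect X + I.expect Y := by
  simp only [expect, mul_add, Finset.sum_add_distrib]

theorem expect_const_mul (a : ℝ) (X : Outcome S n → ℝ) :
    I.expect (fun Z => a * X Z) = a * I.expect X := by
  simp only [expect, Finset.mul_sum]
  exact Finset.sum_congr rfl fun Z _ => by ring

theorem expect_sum {ι : Type*} (t : Finset ι) (X : ι → Outcome S n → ℝ) :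
    I.expect (fun Z => ∑ i ∈ t, X i Z) = ∑ i ∈ t, I.expect (X i) := by
  simp only [expect, Finset.mul_sum]
  exact Finset.sum_comm

theorem expect_const (a : ℝ) : I.expect (fun _ => a) = a := by
  classical
  have h : ∑ Z : Outcome S n, I.outcomeProb Z = 1 := by
    have h1 : ∀ s, ∑ z : Fin n → Bool, ∏ r, (if z r = true then I.prob s r else 1 - I.prob s r) =
        1 := by
      intro s
      rw [← Fintype.prod_sum fun (r : Fin n) (z : Bool) =>
        if z = true then I.prob s r else 1 - I.prob s r]
      simp
    unfold outcomeProb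
    rw [← Fintype.prod_sum fun (s : S) (z : Fin n → Bool) =>
      ∏ r, if z r = true then I.prob s r else 1 - I.prob s r]
    simp [h1]
  rw [expect, ← Finset.sum_mul]
  convert one_mul a

theorem expect_nonneg {X : Outcome S n → ℝ} (h : ∀ Z, 0 ≤ X Z) : 0 ≤ I.expect X :=
  Finset.sum_nonneg fun Z _ => mul_nonneg (I.outcomeProb_nonneg Z) (h Z)

/-- All other factors agree, and for the edge itself the two sides are `±p (1 - p)`: probability `p`
meets the value `1 - p`, and `1 - p` meets `-p`. -/
theorem outcomeProb_flip (s : S) (r : Fin n) (Z : Outcome S n) :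
    I.outcomeProb (flip s r Z) * (success s r (flip s r Z) - I.prob s r) =
      -(I.outcomeProb Z * (success s r Z - I.prob s r)) := by
  classical
  have key : ∀ Z : Outcome S n, I.outcomeProb Z =
      (if Z s r = true then I.prob s r else 1 - I.prob s r) *
        ∏ x ∈ (Finset.univ : Finset (S × Fin n)).erase (s, r),
          if Z x.1 x.2 = true then I.prob x.1 x.2 else 1 - I.prob x.1 x.2 := by
    intro Z
    rw [Finset.mul_prod_erase Finset.univ (fun x : S × Fin n =>
      if Z x.1 x.2 = true then I.prob x.1 x.2 else 1 - I.prob x.1 x.2) (Finset.mem_univ (s, r)),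
      Fintype.prod_prod_type]
    rfl
  have rest : (∏ x ∈ (Finset.univ : Finset (S × Fin n)).erase (s, r),
          if flip s r Z x.1 x.2 = true then I.prob x.1 x.2 else 1 - I.prob x.1 x.2) =
      ∏ x ∈ (Finset.univ : Finset (S × Fin n)).erase (s, r),
          if Z x.1 x.2 = true then I.prob x.1 x.2 else 1 - I.prob x.1 x.2 := by
    refine Finset.prod_congr rfl fun x hx => ?_
    have : ¬ (x.1 = s ∧ x.2 = r) := fun h => (Finset.mem_erase.1 hx).1 (Prod.ext h.1 h.2)
    simp [flip, this]
  rw [key, key, rest]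
  have : flip s r Z s r = !(Z s r) := by simp [flip]
  simp only [success, this]
  cases Z s r <;> simp <;> ring

/-- A quantity that does not depend on the outcome of the edge `{s, r}` is uncorrelated with it. -/
theorem expect_mul_success_sub (s : S) (r : Fin n) (X : Outcome S n → ℝ)
    (hX : ∀ Z, X (flip s r Z) = X Z) :
    I.expect (fun Z => X Z * (success s r Z - I.prob s r)) = 0 := by
  classical
  -- Reindexing by the involution `flip s r` turns the expectation into its own negative.
  have h : I.expect (fun Z => X Z * (success s r Z - I.prob s r)) =
      -I.expect (fun Z => X Z * (success s r Z - I.prob s r)) := by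
    unfold expect
    rw [← Finset.sum_neg_distrib]
    refine Fintype.sum_bijective (flip s r)
      (Function.Involutive.bijective (flip_flip s r)) _ _ fun Z => ?_
    simp only [hX]
    linear_combination X Z * I.outcomeProb_flip s r Z
  linarith

theorem expect_deviation (π : Policy S n) (s : S) (r : Fin n) :
    I.expect (I.deviation π s r) = 0 :=
  I.expect_mul_success_sub s r _ fun Z => assigned_flip π s s le_rfl Z

theorem expect_assigned_mul_success (π : Policy S n) (s : S) (r : Fin n) :
    I.expect (fun Z => assigned π s r Z * success s r Z) =
      I.prob s r * I.expect (assigned π s r) := by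
  rw [← expect_const_mul, ← add_zero (I.expect fun Z => I.prob s r * _),
    ← I.expect_deviation π s r, ← expect_add]
  congr 1
  funext Z
  simp only [deviation]
  ring

/-- Orthogonality of martingale differences: the earlier deviation and the decision for `r` are both
blind to the outcome of `{s, r}`. -/
theorem expect_deviation_mul_of_lt (π : Policy S n) (s : S) {r r' : Fin n} (h : r' < r) :
    I.expect (fun Z => I.deviation π s r' Z * I.deviation π s r Z) = 0 := by
  rw [← I.expect_mul_success_sub s r (fun Z => I.deviation π s r' Z * assigned π s r Z) ?_]
  · congr 1
    funext Z
    simp only [deviation]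
    ring
  · intro Z
    simp only [deviation, assigned_flip π s s h.le, assigned_flip π s s (le_refl r), success,
      flip_of_ne s h.ne]

theorem expect_deviation_mul_of_ne (π : Policy S n) (s : S) {r r' : Fin n} (h : r' ≠ r) :
    I.expect (fun Z => I.deviation π s r' Z * I.deviation π s r Z) = 0 := by
  rcases lt_or_gt_of_ne h with h | h
  · exact I.expect_deviation_mul_of_lt π s h
  · simpa only [mul_comm] using I.expect_deviation_mul_of_lt π s h

theorem expect_deviation_mul_self_le (π : Policy S n) (s : S) (r : Fin n) :
    I.expect (fun Z => I.deviation π s r Z * I.deviation π s r Z) ≤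
      I.expect (fun Z => assigned π s r Z * I.prob s r) := by
  -- For `x ∈ {0, 1}`, `(x - p) ^ 2 = (1 - 2p)(x - p) + p - p ^ 2`; the last term is dropped.
  have h : ∀ Z, I.deviation π s r Z * I.deviation π s r Z ≤
      (1 - 2 * I.prob s r) * I.deviation π s r Z + assigned π s r Z * I.prob s r := by
    intro Z
    have h1 := assigned_mul_self π s r Z
    have h2 : success s r Z * success s r Z = success s r Z := by
      unfold success; split_ifs <;> norm_num
    have h3 := mul_nonneg (assigned_nonneg π s r Z) (mul_self_nonneg (I.prob s r))
    have h4 : I.deviation π s r Z * I.deviation π s r Z = assigned π s r Z *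
        (success s r Z * success s r Z - 2 * I.prob s r * success s r Z +
          I.prob s r * I.prob s r) := by
      rw [deviation]
      linear_combination (success s r Z - I.prob s r) ^ 2 * h1
    rw [h4, h2, deviation]
    linarith
  refine (I.expect_mono h).trans ?_
  rw [expect_add, expect_const_mul, expect_deviation, mul_zero, zero_add]

theorem expect_finalMatches (π : Policy S n) (s : S) :
    I.expect (finalMatches π s) = I.expect (I.finalLoad π s) := by
  unfold finalMatches finalLoad
  rw [expect_sum, expect_sum]
  refine Finset.sum_congr rfl fun r _ => ?_
  rw [expect_assigned_mul_success, ← expect_const_mul]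
  simp only [mul_comm]

theorem expect_sq_finalMatches_sub_finalLoad_le (π : Policy S n) (s : S) :
    I.expect (fun Z => (finalMatches π s Z - I.finalLoad π s Z) ^ 2) ≤
      I.expect (I.finalLoad π s) := by
  simp only [finalMatches_sub_finalLoad, sq, Finset.sum_mul_sum]
  unfold finalLoad
  rw [expect_sum, expect_sum]
  refine Finset.sum_le_sum fun r _ => ?_
  rw [expect_sum, Finset.sum_eq_single r]
  · exact I.expect_deviation_mul_self_le π s r
  · exact fun r' _ h => I.expect_deviation_mul_of_ne π s h.symm
  · simp

variable {I}

/-- Failures can push an individual load above capacity; only the matches are bounded pointwise, and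
they have the same mean. -/
theorem Feasible.expect_finalLoad_le {π : Policy S n} (hπ : I.Feasible π) (s : S) :
    I.expect (I.finalLoad π s) ≤ I.cap s := by
  rw [← expect_finalMatches, ← I.expect_const (I.cap s)]
  exact I.expect_mono fun Z => hπ.finalMatches_le s Z

theorem Feasible.expect_abs_finalMatches_sub_finalLoad_le {π : Policy S n} (hπ : I.Feasible π)
    (s : S) (hs : 0 < I.cap s) :
    I.expect (fun Z => |finalMatches π s Z - I.finalLoad π s Z|) ≤ √(I.cap s) := by
  set q := √(I.cap s : ℝ) with hq
  have hcap : (0 : ℝ) < I.cap s := by exact_mod_cast hs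
  have hq0 : 0 < q := Real.sqrt_pos.2 hcap
  have hqq : q * q = I.cap s := Real.mul_self_sqrt hcap.le
  -- AM-GM replaces Cauchy-Schwarz; with `q = √b_s` and second moment at most `q ^ 2`, each term
  -- contributes at most `q / 2`.
  have h1 : ∀ Z, |finalMatches π s Z - I.finalLoad π s Z| ≤
      (1 / (2 * q)) * (finalMatches π s Z - I.finalLoad π s Z) ^ 2 + q / 2 := by
    intro Z
    rw [← sq_abs (finalMatches π s Z - I.finalLoad π s Z)]
    set x := |finalMatches π s Z - I.finalLoad π s Z|
    have : 1 / (2 * q) * x ^ 2 + q / 2 - x = (x - q) ^ 2 / (2 * q) := by field_simp; ring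
    have h2 : 0 ≤ (x - q) ^ 2 / (2 * q) := by positivity
    linarith
  refine (I.expect_mono h1).trans ?_
  rw [expect_add, expect_const_mul, expect_const]
  have h2 := (I.expect_sq_finalMatches_sub_finalLoad_le π s).trans (hπ.expect_finalLoad_le s)
  calc _ ≤ 1 / (2 * q) * (q * q) + q / 2 := by rw [hqq]; gcongr
    _ = q := by field_simp; ring

/-! ### Expected reward, and the comparison of the two benchmarks. -/

variable (I)

theorem expectedReward_eq (π : Policy S n) :
    I.expectedReward π = ∑ s, I.weight s * I.expect (I.finalLoad π s) := by
  have h : I.expectedReward π = I.expect fun Z => ∑ s, I.weight s * finalMatches π s Z := by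
    unfold expectedReward expect
    refine Finset.sum_congr rfl fun Z _ => ?_
    congr 1
    unfold reward finalMatches
    refine Finset.sum_congr rfl fun s _ => ?_
    rw [Finset.mul_sum]
    refine Finset.sum_congr rfl fun r _ => ?_
    unfold assigned success
    split_ifs <;> simp_all
  rw [h, expect_sum]
  exact Finset.sum_congr rfl fun s _ => by rw [expect_const_mul, expect_finalMatches]

theorem expectedReward_nonneg (π : Policy S n) : 0 ≤ I.expectedReward π := by
  rw [expectedReward_eq]
  exact Finset.sum_nonneg fun s _ =>
    mul_nonneg (I.weight_nonneg s) (I.expect_nonneg (I.finalLoad_nonneg π s))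

/-- The assignment probabilities of a feasible policy are a feasible fractional solution. -/
theorem policyValues_subset_fractionalValues : I.policyValues ⊆ I.fractionalValues := by
  rintro v ⟨π, hπ, rfl⟩
  have hload : ∀ s, I.expect (I.finalLoad π s) =
      ∑ r, I.prob s r * I.expect (assigned π s r) := by
    intro s
    unfold finalLoad
    rw [expect_sum]
    refine Finset.sum_congr rfl fun r _ => ?_
    rw [← expect_const_mul]
    simp only [mul_comm]
  refine ⟨fun s r => I.expect (assigned π s r), ⟨?_, ?_, ?_, ?_⟩, ?_⟩
  · exact fun s r => I.expect_nonneg (assigned_nonneg π s r)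
  · intro s r h
    have : assigned π s r = fun _ => 0 := by
      funext Z
      refine if_neg fun hd => h ?_
      rw [decision_eq] at hd
      exact (hπ r _ s hd).1
    rw [this, expect_const]
  · exact fun s => (hload s).symm.trans_le (hπ.expect_finalLoad_le s)
  · intro r
    rw [← expect_sum]
    exact (I.expect_mono fun Z => sum_assigned_le_one π r Z).trans_eq (I.expect_const 1)
  · rw [expectedReward_eq]
    refine Finset.sum_congr rfl fun s _ => ?_
    rw [hload, Finset.mul_sum]
    exact Finset.sum_congr rfl fun r _ => by ring

/-! ### The primal-dual analysis. -/

/-- Weak duality. -/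
theorem mul_le_of_dual_feasible {a : S → ℝ} {β : Fin n → ℝ} {γ v : ℝ} (ha : ∀ s, 0 ≤ a s)
    (hβ : ∀ r, 0 ≤ β r)
    (hdual : ∀ s r, I.edge s r → γ * (I.weight s * I.prob s r) ≤ I.prob s r * a s + β r)
    (hv : v ∈ I.fractionalValues) : γ * v ≤ ∑ s, I.cap s * a s + ∑ r, β r := by
  obtain ⟨m, hm, rfl⟩ := hv
  have h1 : γ * ∑ s, ∑ r, I.prob s r * I.weight s * m s r ≤
      ∑ s, ∑ r, (a s * (I.prob s r * m s r) + β r * m s r) := by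
    simp only [Finset.mul_sum]
    refine Finset.sum_le_sum fun s _ => Finset.sum_le_sum fun r _ => ?_
    by_cases h : I.edge s r
    · have := mul_le_mul_of_nonneg_right (hdual s r h) (hm.nonneg s r)
      linarith
    · simp [hm.edge s r h]
  refine h1.trans ?_
  simp only [Finset.sum_add_distrib]
  refine add_le_add (Finset.sum_le_sum fun s _ => ?_) ?_
  · rw [← Finset.mul_sum, mul_comm]
    exact mul_le_mul_of_nonneg_right (hm.cap s) (ha s)
  · rw [Finset.sum_comm]
    refine Finset.sum_le_sum fun r _ => ?_
    rw [← Finset.mul_sum]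
    exact mul_le_of_le_one_right (hβ r) (hm.request r)

/-- The price of the request `r` in an execution of `π`. -/
def requestPrice (π : Policy S n) (r : Fin n) (Z : Outcome S n) : ℝ :=
  ∑ s, assigned π s r Z * (I.weight s * (I.prob s r * (1 - I.balanceAt π s r Z)))

theorem requestPrice_nonneg (π : Policy S n) (r : Fin n) (Z : Outcome S n) :
    0 ≤ I.requestPrice π r Z :=
  Finset.sum_nonneg fun s _ => mul_nonneg (assigned_nonneg π s r Z) (mul_nonneg
    (I.weight_nonneg s) (mul_nonneg (I.prob_nonneg s r) (sub_nonneg.2 (balanceFun_le_one _ _))))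

theorem sum_serverPrice_add_sum_requestPrice (hcap : ∀ s, 0 < I.cap s) (π : Policy S n)
    (Z : Outcome S n) :
    ∑ s, I.cap s * I.serverPrice π s Z + ∑ r, I.requestPrice π r Z =
      ∑ s, I.weight s * I.finalLoad π s Z := by
  unfold serverPrice requestPrice finalLoad
  rw [Finset.sum_comm (s := (Finset.univ : Finset (Fin n))), ← Finset.sum_add_distrib]
  refine Finset.sum_congr rfl fun s _ => ?_
  have : (I.cap s : ℝ) ≠ 0 := by exact_mod_cast (hcap s).ne'
  simp only [Finset.mul_sum]
  rw [← Finset.sum_add_distrib]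
  refine Finset.sum_congr rfl fun r _ => ?_
  field_simp
  ring

variable {I}

/-- An available neighbour forces an assignment, so the price of `r` is the score of the chosen
server, which is maximal. -/
theorem IsStochasticBalance.score_le_requestPrice {π : Policy S n}
    (hπ : I.IsStochasticBalance π) {r : Fin n} {s : S} (Z : Outcome S n)
    (hs : I.Available (observed π Z (· < r)) r s) :
    I.score (observed π Z (· < r)) r s ≤ I.requestPrice π r Z := by
  classical
  obtain ⟨h1, h2⟩ := hπ r (observed π Z (· < r))
  rw [← decision_eq π Z r] at h1 h2
  cases hd : decision π Z r with
  | none => exact absurd hs (h2 hd s)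
  | some t =>
    refine ((h1 t hd).2 s hs).trans ?_
    have : I.requestPrice π r Z = I.score (observed π Z (· < r)) r t := by
      unfold requestPrice
      rw [Finset.sum_eq_single t]
      · simp [assigned, hd, score, balanceAt]
      · intro u _ hu
        simp [assigned, hd, hu.symm]
      · simp
    rw [this]

/-- In each execution the prices are feasible for the dual, up to the factor `1 - 1 / e` and the
deviation of the number of matches of the server from its load. -/
theorem IsStochasticBalance.le_price {π : Policy S n} (hπ : I.IsStochasticBalance π)
    {r : Fin n} {s : S} (hs : 0 < I.cap s) (hedge : I.edge s r) (Z : Outcome S n) :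
    I.weight s * I.prob s r * (1 - Real.exp (-1)) ≤
      I.prob s r * ((1 + 1 / I.cap s) * I.serverPrice π s Z) + I.requestPrice π r Z +
        I.weight s * I.prob s r / I.cap s * |finalMatches π s Z - I.finalLoad π s Z| := by
  have hw := I.weight_nonneg s
  have hp := I.prob_nonneg s r
  have hwp := mul_nonneg hw hp
  have h1 := mul_le_mul_of_nonneg_left (I.le_serverPrice π s hs Z) hp
  have hr := I.requestPrice_nonneg π r Z
  by_cases hav : I.Available (observed π Z (· < r)) r s
  -- The load at arrival is at most the final load, so monotonicity of `f_s` lets the `f_s` terms of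
  -- the two prices cancel.
  · have h2 := hπ.score_le_requestPrice Z hav
    have h3 := balanceFun_mono (I.cap s) (I.load_observed_lt_le π s r Z)
    have h4 := mul_le_mul_of_nonneg_left h3 hwp
    have h5 : 0 ≤ I.weight s * I.prob s r / I.cap s *
      |finalMatches π s Z - I.finalLoad π s Z| := by positivity
    rw [score] at h2
    linarith
  -- The server is exhausted, so the request may pay nothing towards this edge; the deviation term
  -- covers `1 - f_s(final load)`.
  · have hfull : finalMatches π s Z = I.cap s := by
      refine le_antisymm (hπ.feasible.finalMatches_le s Z) ?_
      rw [← natCast_numMatches_observed, Nat.cast_le]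
      have h2 : I.cap s ≤ numMatches (observed π Z (· < r)) s :=
        not_lt.1 fun h => hav ⟨hedge, h⟩
      exact h2.trans (numMatches_observed_mono π s Z fun _ _ => trivial)
    have h2 := mul_le_mul_of_nonneg_left (one_sub_balanceFun_le hs (I.finalLoad π s Z)) hwp
    rw [hfull, div_mul_eq_mul_div, mul_div_assoc]
    linarith

/-- The dual solution consists of expected prices, since the deviation error is controlled only on
average. Server prices carry the extra factor `1 + 1 / b`. -/
theorem IsStochasticBalance.mul_le_expectedReward {π : Policy S n}
    (hπ : I.IsStochasticBalance π) {b : ℕ} (hb : 0 < b) (hcap : ∀ s, b ≤ I.cap s) {v : ℝ}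
    (hv : v ∈ I.fractionalValues) :
    (1 - Real.exp (-1) - 1 / √b) * v ≤ (1 + 1 / b) * I.expectedReward π := by
  have hcap' : ∀ s, 0 < I.cap s := fun s => hb.trans_le (hcap s)
  have hb' : (0 : ℝ) < b := by exact_mod_cast hb
  have hA : ∀ s, 0 ≤ I.expect (I.serverPrice π s) :=
    fun s => I.expect_nonneg (I.serverPrice_nonneg π s)
  have hB : ∀ r, 0 ≤ I.expect (I.requestPrice π r) :=
    fun r => I.expect_nonneg (I.requestPrice_nonneg π r)
  have key := I.mul_le_of_dual_feasible (a := fun s => (1 + 1 / b) * I.expect (I.serverPrice π s))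
    (β := fun r => I.expect (I.requestPrice π r)) (γ := 1 - Real.exp (-1) - 1 / √b)
    (fun s => mul_nonneg (by positivity) (hA s)) hB ?_ hv
  · refine key.trans ?_
    have hsum := congrArg I.expect (funext fun Z =>
      I.sum_serverPrice_add_sum_requestPrice hcap' π Z)
    simp only [expect_add, expect_sum, expect_const_mul] at hsum
    rw [expectedReward_eq, ← hsum, mul_add, Finset.mul_sum]
    refine add_le_add (le_of_eq (Finset.sum_congr rfl fun s _ => by ring)) ?_
    refine le_mul_of_one_le_left (Finset.sum_nonneg fun r _ => hB r) ?_
    have : 0 < 1 / (b : ℝ) := by positivity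
    linarith
  · intro s r hedge
    have hc : (0 : ℝ) < I.cap s := by exact_mod_cast hcap' s
    have hbc : (b : ℝ) ≤ I.cap s := by exact_mod_cast hcap s
    have hwp := mul_nonneg (I.weight_nonneg s) (I.prob_nonneg s r)
    have h1 := I.expect_mono fun Z => hπ.le_price (hcap' s) hedge Z
    simp only [expect_add, expect_const_mul, expect_const] at h1
    have h2 : I.weight s * I.prob s r / I.cap s *
        I.expect (fun Z => |finalMatches π s Z - I.finalLoad π s Z|) ≤
          I.weight s * I.prob s r * (1 / √b) := by
      calc _ ≤ I.weight s * I.prob s r / I.cap s * √(I.cap s) := by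
            gcongr
            exact hπ.feasible.expect_abs_finalMatches_sub_finalLoad_le s (hcap' s)
        _ = I.weight s * I.prob s r * (√(I.cap s) / I.cap s) := by ring
        _ = I.weight s * I.prob s r * (1 / √(I.cap s)) := by
            rw [Real.sqrt_div_self', one_div]
        _ ≤ _ := by gcongr
    have h3 : I.prob s r * ((1 + 1 / I.cap s) * I.expect (I.serverPrice π s)) ≤
        I.prob s r * ((1 + 1 / b) * I.expect (I.serverPrice π s)) := by
      have := hA s
      have := I.prob_nonneg s r
      gcongr
    linarith

end Expectation

end Instance

end StochReward

end

theorem mainTheorem4 :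
    ∃ c : ℕ → ℝ, Tendsto c atTop (𝓝 (1 - 1 / Real.exp 1)) ∧
      ∀ (S : Type*) [Fintype S] (n : ℕ) (I : StochReward.Instance S n) (b : ℕ),
        (∀ s, b ≤ I.cap s) →
        ∀ π : StochReward.Policy S n, I.IsStochasticBalance π →
          c b * I.opt ≤ I.expectedReward π ∧ c b * I.sopt ≤ I.expectedReward π := by
  have he : 1 / Real.exp 1 = Real.exp (-1) := by rw [Real.exp_neg, one_div]
  have he1 : Real.exp (-1) ≤ 1 := Real.exp_le_one_iff.2 (by norm_num)
  -- `b / (b + 1)` inverts the loss `1 + 1 / b`. Truncation at 0 makes the bound trivial for small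
  -- `b` and allows multiplying suprema by the constant.
  refine ⟨fun b => max 0 ((b : ℝ) / (b + 1) * (1 - Real.exp (-1) - 1 / √b)), ?_, ?_⟩
  · have h1 : Tendsto (fun b : ℕ => (b : ℝ) / (b + 1)) atTop (𝓝 1) :=
      tendsto_natCast_div_add_atTop 1
    have h2 : Tendsto (fun b : ℕ => 1 / √(b : ℝ)) atTop (𝓝 0) := by
      simp only [one_div]
      exact (Real.tendsto_sqrt_atTop.comp tendsto_natCast_atTop_atTop).inv_tendsto_atTop
    have h3 := (tendsto_const_nhds (x := (0 : ℝ))).max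
      (h1.mul ((tendsto_const_nhds (x := 1 - Real.exp (-1))).sub h2))
    rw [he]
    convert h3 using 2
    rw [one_mul, sub_zero, max_eq_right (by linarith)]
  · intro S _ n I b hcap π hπ
    have key : ∀ v ∈ I.fractionalValues,
        max 0 ((b : ℝ) / (b + 1) * (1 - Real.exp (-1) - 1 / √b)) * v ≤ I.expectedReward π := by
      intro v hv
      rcases max_choice 0 ((b : ℝ) / (b + 1) * (1 - Real.exp (-1) - 1 / √b)) with h | h
      · rw [h, zero_mul]
        exact I.expectedReward_nonneg π
      rw [h]
      -- At `b = 0` the factor `b / (b + 1)` vanishes, so the convention `1 / 0 = 0` is harmless.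
      rcases Nat.eq_zero_or_pos b with rfl | hb
      · simpa using I.expectedReward_nonneg π
      have hb' : (0 : ℝ) < b := by exact_mod_cast hb
      have h1 := mul_le_mul_of_nonneg_left (hπ.mul_le_expectedReward hb hcap hv)
        (show 0 ≤ (b : ℝ) / (b + 1) by positivity)
      rw [mul_assoc]
      refine h1.trans_eq ?_
      field_simp
    -- One bound serves both benchmarks, as policy values are fractional values.
    have sup : ∀ A : Set ℝ, A.Nonempty → A ⊆ I.fractionalValues →
        max 0 ((b : ℝ) / (b + 1) * (1 - Real.exp (-1) - 1 / √b)) * sSup A ≤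
          I.expectedReward π := by
      intro A hne hA
      rcases (le_max_left 0 ((b : ℝ) / (b + 1) * (1 - Real.exp (-1) - 1 / √b))).eq_or_lt with
        h | h
      · rw [← h, zero_mul]
        exact I.expectedReward_nonneg π
      · rw [mul_comm, ← le_div_iff₀ h]
        refine csSup_le hne fun v hv => ?_
        rw [le_div_iff₀ h, mul_comm]
        exact key v (hA hv)
    exact ⟨sup _ I.fractionalValues_nonempty subset_rfl,
      sup _ I.policyValues_nonempty I.policyValues_subset_fractionalValues⟩
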